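/- All graphs are finite, simple and undirected, and $G$ is a connected graph. Its 2-fold interlacement $G[:]$ is the graph with two vertices $v'$, $v''$ ("twins") for each vertex $v$ of $G$, and with the four edges $v'u'$, $v'u''$, $v''u'$, $v''u''$ for each edge $vu$ of $G$ (and no other edges). A spinal quadrangulation $Q(G[:])$ with spine $G$ is any embedding of $G[:]$ in a closed orientable surface obtained as follows. For each vertex $v$ take an oriented sphere $S_v$ with poles $v'$ (north) and $v''$ (south). Along its equator, in an arbitrary cyclic order, cut out one quadrilateral hole $h_{vu}$ for each neighbour $u$ of $v$. Join $v'$ by arcs to the two upper corners, and $v''$ to the two lower corners, of each hole of $S_v$. For each edge $vu$ attach a tube, compatibly with the orientations, connecting the boundaries of $h_{vu}$ and $h_{uv}$, with a quarter-twist in either direction (chosen arbitrarily for each edge). The four long edges of the tube join the corners of $h_{vu}$ to those of $h_{uv}$ and thus complete the arcs to the four edges of $G[:]$ over $vu$. Let $\chi_V$ denote the vertex chromatic number of a graph. Let $\chi_F(Q)$ denote the face chromatic number of $Q$: the least number of colours in a colouring of the faces of $Q$ in which any two different faces that meet a common edge receive different colours. **Lemma 3.4.** For every spinal quadrangulation $Q(G[:])$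 with spine $G$, $$\chi_V(G[:]) = \chi_V(G) \ge \chi_F(Q(G[:])).$$ The equality holds for every finite connected graph $G$. -/

import Mathlib

universe u

namespace Spinal

/-- The 2-fold interlacement `G[:]` of `G`. The vertex `v` of `G` has the twins
`v' = (v, false)` and `v'' = (v, true)`; for every edge `vu` of `G` all four pairs
`v'u'`, `v'u''`, `v''u'`, `v''u''` are edges, and there are no other edges. -/
def interlacement {V : Type u} (G : SimpleGraph V) : SimpleGraph (V × Bool) where
  Adj x y := G.Adj x.1 y.1
  symm := ⟨fun _ _ h => G.adj_symm h⟩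
  loopless := ⟨fun x h => G.loopless.irrefl x.1 h⟩

/-- A cellular embedding of a graph `H` in a closed oriented surface, given by its rotation
system: `next` sends a dart (oriented edge) to the one that follows it in the counterclockwise
order around its initial vertex. The darts leaving a vertex form a single cycle. -/
@[ext]
structure Embedding {W : Type u} (H : SimpleGraph W) where
  next : Equiv.Perm H.Dart
  fst_next : ∀ d, (next d).fst = d.fst
  sameCycle : ∀ d e : H.Dart, d.fst = e.fst → next.SameCycle d e

namespace Embedding

variable {W : Type u} {H : SimpleGraph W}

/-- The successor of a dart on the boundary walk of the face on its right-hand side: arrive at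
the terminal vertex, turn back, and take the next dart in the rotation at that vertex. -/
def faceNext (Q : Embedding H) : Equiv.Perm H.Dart :=
  (Function.Involutive.toPerm SimpleGraph.Dart.symm SimpleGraph.Dart.symm_involutive).trans Q.next

/-- The faces of an embedding: the closed boundary walks, i.e. the orbits of `faceNext`. -/
def Face (Q : Embedding H) : Type u :=
  Quotient (Equiv.Perm.SameCycle.setoid Q.faceNext)

/-- The face on the right-hand side of a dart. -/
def face (Q : Embedding H) (d : H.Dart) : Q.Face :=
  Quotient.mk (Equiv.Perm.SameCycle.setoid Q.faceNext) d

/-- The face `F` meets the edge `e`: the boundary walk of `F` traverses `e` in some direction. -/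
def Meets (Q : Embedding H) (F : Q.Face) (e : Sym2 W) : Prop :=
  ∃ d : H.Dart, Q.face d = F ∧ d.edge = e

/-- Two faces are adjacent if they are different and meet the same edge. -/
def faceGraph (Q : Embedding H) : SimpleGraph Q.Face where
  Adj F F' := F ≠ F' ∧ ∃ e : Sym2 W, Q.Meets F e ∧ Q.Meets F' e
  symm := ⟨fun _ _ h => ⟨h.1.symm, h.2.imp fun _ he => ⟨he.2, he.1⟩⟩⟩
  loopless := ⟨fun _ h => h.1 rfl⟩

/-- The face chromatic number: the least number of colours in a proper face colouring. -/
noncomputable def faceChromaticNumber (Q : Embedding H) : ℕ∞ :=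
  Q.faceGraph.chromaticNumber

end Embedding

variable {V : Type u} {G : SimpleGraph V}

/-- A corner of a hole. For each vertex `v` of `G` there is a sphere `S_v` with north pole `v'`
and south pole `v''` and with one quadrilateral hole `h_vu` on the equator for each neighbour `u`
of `v`. The hole `h_vu` is given by the dart `vu` of `G`. Seen from outside the sphere with
north up, `(vu, a, r)` is the upper (`a = false`) or lower (`a = true`), left (`r = false`)
or right (`r = true`) corner of `h_vu`.
On `S_v` an arc is drawn from `v'` to each upper corner and from `v''` to each lower corner. -/
abbrev Corner (G : SimpleGraph V) : Type u := G.Dart × Bool × Bool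

/-- The counterclockwise successor (seen from outside the sphere `S_v`) of an arc from a pole
to a corner. The cyclic order in which the holes lie on the equator of `S_v`, from left to right,
is that of the rotation `R` at `v`: around `v'` one runs through the holes from left to right,
around `v''` from right to left. -/
def cornerNextFun (R : Embedding G) : Corner G → Corner G
  | (e, false, false) => (e, false, true)
  | (e, false, true) => (R.next e, false, false)
  | (e, true, true) => (e, true, false)
  | (e, true, false) => (R.next.symm e, true, true)

/-- The clockwise successor of an arc; see `cornerNextFun`. -/
def cornerPrevFun (R : Embedding G) : Corner G → Corner G
  | (e, false, true) => (e, false, false)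
  | (e, false, false) => (R.next.symm e, false, true)
  | (e, true, false) => (e, true, true)
  | (e, true, true) => (R.next e, true, false)

/-- `cornerNextFun` as a permutation. -/
def cornerNext (R : Embedding G) : Equiv.Perm (Corner G) where
  toFun := cornerNextFun R
  invFun := cornerPrevFun R
  left_inv := by rintro ⟨e, _ | _, _ | _⟩ <;> simp [cornerNextFun, cornerPrevFun]
  right_inv := by rintro ⟨e, _ | _, _ | _⟩ <;> simp [cornerNextFun, cornerPrevFun]

/-- Closing the holes by tubes. For each edge `vu` of `G` the boundaries of `h_vu` and `h_uv` are
connected by a tube with four long edges that join the corners of the two holes in pairs.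
As the tube reverses orientation and gets a quarter-twist, it joins (upper left, upper right,
lower right, lower left) of `h_vu` with (upper left, lower left, lower right, upper right) of
`h_uv` for one direction of the twist (`t vu = false`), and with
(lower right, upper right, upper left, lower left) for the other one (`t vu = true`).
Hence in both cases an arc that leaves a pole of `S_v` through a left corner of `h_vu` ends at
`u'` if `t vu = false` and at `u''` if `t vu = true`, and through a right corner at the other twin.
This identifies the arcs at the poles with the darts of `G[:]`. -/
def arcEquiv (t : Sym2 V → Bool) : Corner G ≃ (interlacement G).Dart where
  toFun c := ⟨((c.1.fst, c.2.1), (c.1.snd, xor c.2.2 (t c.1.edge))), c.1.adj⟩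
  invFun d := (⟨(d.fst.1, d.snd.1), d.adj⟩, d.fst.2, xor d.snd.2 (t s(d.fst.1, d.snd.1)))
  left_inv := by
    rintro ⟨⟨⟨v, u⟩, h⟩, a, r⟩
    simp [SimpleGraph.Dart.edge]
  right_inv := by
    rintro ⟨⟨⟨v, a⟩, ⟨u, b⟩⟩, h⟩
    simp [SimpleGraph.Dart.edge]

theorem cornerNext_fst (R : Embedding G) (c : Corner G) :
    (cornerNext R c).1.fst = c.1.fst ∧ (cornerNext R c).2.1 = c.2.1 := by
  have h : ∀ e, (R.next.symm e).fst = e.fst := fun e => by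
    have := R.fst_next (R.next.symm e)
    simpa using this.symm
  rcases c with ⟨e, _ | _, _ | _⟩ <;> simp [cornerNext, cornerNextFun, R.fst_next, h]

theorem cornerNext_sameCycle (R : Embedding G) (c c' : Corner G)
    (h : c.1.fst = c'.1.fst) (ha : c.2.1 = c'.2.1) : (cornerNext R).SameCycle c c' := by
  have step : ∀ x, (cornerNext R).SameCycle x (cornerNext R x) := fun x => ⟨1, by simp⟩
  have col : ∀ e a r, (cornerNext R).SameCycle (e, a, false) (e, a, r) := by
    rintro e (_ | _) (_ | _)
    · exact .rfl
    · exact step _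
    · exact .rfl
    · exact (step (e, true, true)).symm
  have one : ∀ e a, (cornerNext R).SameCycle (e, a, false) (R.next e, a, false) := by
    rintro e (_ | _)
    · exact (col e false true).trans (step _)
    · refine ((col (R.next e) true true).trans (step _) |>.trans ?_).symm
      have := step (R.next e, true, false)
      simp only [cornerNext, cornerNextFun, Equiv.coe_fn_mk, Equiv.symm_apply_apply] at this ⊢
      exact this.trans (col e true true).symm
  have all : ∀ (e : G.Dart) (a : Bool) (k : ℤ),
      (cornerNext R).SameCycle (e, a, false) ((R.next ^ k) e, a, false) := by
    intro e a k
    induction k using Int.induction_on with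
    | zero => exact .rfl
    | succ k ih =>
      refine ih.trans ?_
      rw [add_comm, zpow_add, zpow_one]
      exact one _ a
    | pred k ih =>
      refine ih.trans (Equiv.Perm.SameCycle.symm ?_)
      have := one ((R.next ^ (-(k : ℤ) - 1)) e) a
      rwa [← Equiv.Perm.mul_apply, ← zpow_one_add, add_sub_cancel] at this
  obtain ⟨e, a, r⟩ := c
  obtain ⟨e', a', r'⟩ := c'
  obtain rfl : a = a' := ha
  obtain ⟨k, rfl⟩ := R.sameCycle e e' h
  exact ((col e a r).symm.trans (all e a k)).trans (col _ a r')

/-- The embedding of `G[:]` produced by the spinal construction, for given cyclic orders of the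
holes on the spheres `S_v` and given directions of the quarter-twists. -/
def spinalEmbedding (R : Embedding G) (t : Sym2 V → Bool) : Embedding (interlacement G) where
  next := (arcEquiv t).permCongr (cornerNext R)
  fst_next d := by
    have h := cornerNext_fst R ((arcEquiv t).symm d)
    exact Prod.ext h.1 h.2
  sameCycle d e h := by
    obtain ⟨k, hk⟩ := cornerNext_sameCycle R ((arcEquiv t).symm d) ((arcEquiv t).symm e)
      (show d.fst.1 = e.fst.1 from congrArg Prod.fst h) (congrArg Prod.snd h)
    refine ⟨k, ?_⟩
    have hp : ((arcEquiv t).permCongr (cornerNext R)) ^ k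
        = (arcEquiv t).permCongr ((cornerNext R) ^ k) :=
      (map_zpow (arcEquiv t).permCongrHom (cornerNext R) k).symm
    rw [hp, Equiv.permCongr_apply, hk, Equiv.apply_symm_apply]

/-- `Q` is a spinal quadrangulation with spine `G`: it can be obtained by the spinal
construction, for some pairing of the holes (that is, some cyclic order of the holes on each
sphere) and some directions of the twists. -/
def IsSpinalQuadrangulation (Q : Embedding (interlacement G)) : Prop :=
  ∃ (R : Embedding G) (t : Sym2 V → Bool), Q = spinalEmbedding R t

end Spinal

namespace Spinal

variable {V : Type*} {G : SimpleGraph V}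

/-! The two homomorphisms below transport colourings between `G` and `G[:]`. For the faces, cut the
surface back into spheres and tubes. The equator of `S_w` leaves one middle region between
consecutive holes, and a triangle lies between each pole and each hole. The quarter-twist glues the
top and bottom sides of `h_vu` to the left and right sides of `h_uv`, and vice versa, so a face
consists of one middle region, on some `S_w`, continued through tubes into triangles on neighbouring
spheres. Its centre `w` is thus well defined (`dartCentre_faceNext`). Across an edge over `vu`, one
face is centred at `v` and the other at `u` (`adj_dartCentre_symm`). Hence a vertex colouring of
`G`, read at the centres, properly colours the faces. -/

/-- The projection of `G[:]` onto its spine. -/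
def interlacementProj (G : SimpleGraph V) : interlacement G →g G where
  toFun := Prod.fst
  map_rel' h := h

/-- The inclusion of the spine as the graph on the upper twins. -/
def interlacementIncl (G : SimpleGraph V) : G →g interlacement G where
  toFun v := (v, false)
  map_rel' h := h

theorem chromaticNumber_interlacement (G : SimpleGraph V) :
    (interlacement G).chromaticNumber = G.chromaticNumber :=
  le_antisymm (SimpleGraph.chromaticNumber_mono_of_hom (interlacementProj G))
    (SimpleGraph.chromaticNumber_mono_of_hom (interlacementIncl G))

/-- The face on the right-hand side of an arc contains the part of exactly one sphere `S_w` that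
lies between two consecutive holes; `cornerCentre` is the vertex `w`. -/
def cornerCentre (c : Corner G) : V :=
  -- Upper left and lower right arcs have a middle region of their own sphere on the right; the
  -- other two have a triangle, which the twisted tube continues to a middle region at the far end.
  if c.2.1 = c.2.2 then c.1.fst else c.1.snd

/-- `cornerCentre` in terms of the darts of `G[:]`. -/
def dartCentre (t : Sym2 V → Bool) (d : (interlacement G).Dart) : V :=
  cornerCentre ((arcEquiv t).symm d)

theorem fst_next_symm (R : Embedding G) (e : G.Dart) : (R.next.symm e).fst = e.fst := by
  have h := R.fst_next (R.next.symm e)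
  rw [Equiv.apply_symm_apply] at h
  exact h.symm

/-- The quarter-twist exchanges the pole bit with the side bit, and its direction flips both or
neither. Whether the two bits agree is therefore the same from both ends of an arc. -/
theorem arcEquiv_symm_symm (t : Sym2 V → Bool) (d : (interlacement G).Dart) :
    (arcEquiv t).symm d.symm =
      (((arcEquiv t).symm d).1.symm,
        xor ((arcEquiv t).symm d).2.2 (t ((arcEquiv t).symm d).1.edge),
        xor ((arcEquiv t).symm d).2.1 (t ((arcEquiv t).symm d).1.edge)) := by
  rcases d with ⟨⟨⟨v, a⟩, ⟨u, b⟩⟩, h⟩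
  simp [arcEquiv, SimpleGraph.Dart.edge, SimpleGraph.Dart.symm, Sym2.eq_swap (a := u) (b := v)]

/-- Turning around on an arc and taking the next arc does not change the centre. -/
theorem cornerCentre_cornerNext (R : Embedding G) (e : G.Dart) (a r s : Bool) :
    cornerCentre (cornerNext R (e.symm, xor r s, xor a s)) = cornerCentre (e, a, r) := by
  -- If `a = r`, the rotation stays at the same hole and makes the bits differ, so the centre is
  -- `e.symm.snd = e.fst`. Otherwise it passes to an adjacent hole and makes them agree, so the
  -- centre is `e.symm.fst = e.snd`.
  rcases a <;> rcases r <;> rcases s <;>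
    simp [cornerCentre, cornerNext, cornerNextFun, R.fst_next, fst_next_symm]

theorem dartCentre_faceNext (R : Embedding G) (t : Sym2 V → Bool) (d : (interlacement G).Dart) :
    dartCentre t ((spinalEmbedding R t).faceNext d) = dartCentre t d := by
  have h : (arcEquiv t).symm ((spinalEmbedding R t).faceNext d) =
      cornerNext R ((arcEquiv t).symm d.symm) := by
    simp [Embedding.faceNext, spinalEmbedding]
  rw [dartCentre, h, arcEquiv_symm_symm, cornerCentre_cornerNext]
  rfl

/-- Reversal preserves agreement of the bits but swaps the ends of the spine edge, so the two
centres are its two ends. -/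
theorem adj_dartCentre_symm (t : Sym2 V → Bool) (d : (interlacement G).Dart) :
    G.Adj (dartCentre t d) (dartCentre t d.symm) := by
  rw [dartCentre, dartCentre, arcEquiv_symm_symm]
  obtain ⟨e, a, r⟩ := (arcEquiv t).symm d
  by_cases h : a = r
  · simp [cornerCentre, h]
  · simpa [cornerCentre, h, Ne.symm h] using e.adj.symm

theorem dartCentre_eq_of_sameCycle (R : Embedding G) (t : Sym2 V → Bool)
    {d e : (interlacement G).Dart} (h : (spinalEmbedding R t).faceNext.SameCycle d e) :
    dartCentre t d = dartCentre t e := by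
  obtain ⟨k, rfl⟩ := h
  induction k using Int.induction_on with
  | zero => rfl
  | succ k ih => rw [add_comm, zpow_one_add, Equiv.Perm.mul_apply, dartCentre_faceNext, ← ih]
  | pred k ih =>
    have h := dartCentre_faceNext R t (((spinalEmbedding R t).faceNext ^ (-(k : ℤ) - 1)) d)
    rw [← Equiv.Perm.mul_apply, ← zpow_one_add, add_sub_cancel] at h
    exact ih.trans h

/-- The vertex of the spine whose sphere carries the middle part of a face. -/
def faceCentre (R : Embedding G) (t : Sym2 V → Bool) : (spinalEmbedding R t).Face → V :=
  Quotient.lift (dartCentre t) fun _ _ h => dartCentre_eq_of_sameCycle R t h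

/-- Sending each face to its centre is a homomorphism from the dual graph to the spine. -/
def faceGraphHom (R : Embedding G) (t : Sym2 V → Bool) :
    (spinalEmbedding R t).faceGraph →g G where
  toFun := faceCentre R t
  map_rel' := by
    rintro _ _ ⟨hne, _, ⟨d, rfl, hd⟩, ⟨d', rfl, rfl⟩⟩
    -- Equal darts would give equal faces, so the two faces lie on opposite sides of the edge.
    rcases SimpleGraph.dart_edge_eq_iff _ _ |>.1 hd with rfl | rfl
    · exact absurd rfl hne
    · exact (adj_dartCentre_symm t d').symm

theorem faceChromaticNumber_le {Q : Embedding (interlacement G)}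
    (hQ : IsSpinalQuadrangulation Q) : Q.faceChromaticNumber ≤ G.chromaticNumber := by
  obtain ⟨R, t, rfl⟩ := hQ
  exact SimpleGraph.chromaticNumber_mono_of_hom (faceGraphHom R t)

end Spinal

theorem lemma3p4 {V : Type*} [Finite V] (G : SimpleGraph V) (hG : G.Connected) :
    (Spinal.interlacement G).chromaticNumber = G.chromaticNumber ∧
      ∀ Q : Spinal.Embedding (Spinal.interlacement G), Spinal.IsSpinalQuadrangulation Q →
        G.chromaticNumber ≥ Q.faceChromaticNumber :=
  ⟨Spinal.chromaticNumber_interlacement G, fun _ hQ => Spinal.faceChromaticNumber_le hQ⟩
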